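/- Let $k$ be a field and let $f\in k[x,y]\setminus k$. A dicritical divisor of $f$ is a discrete valuation ring $R_v$ with quotient field $k(x,y)$ such that $k[x,y]\not\subseteq R_v$, $k(f)\subseteq R_v$, and the residue $\mathrm{Res}(f)$ of $f$ in the residue field $K_v=R_v/\mathfrak{m}_v$ is transcendental over $k$ (here $k\subseteq k(f)\subseteq R_v$, so $K_v$ is an extension field of $k$). Let $R_v$ be a dicritical divisor of $f$, and let $k'$ be the relative algebraic closure of $k$ in $K_v$. Then there is an element $t\in K_v$, transcendental over $k$, such that $K_v=k'(t)$ and $\mathrm{Res}(f)\in k'[t]$. -/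

import Mathlib

open scoped IntermediateField

noncomputable section

/-- The rational function field `k(x,y)`. -/
abbrev RatFunc₂ (k : Type*) [Field k] : Type _ :=
  FractionRing (MvPolynomial (Fin 2) k)

/-- The polynomial `f ∈ k[x,y]` viewed in `k(x,y)`. -/
abbrev toRat {k : Type*} [Field k] (f : MvPolynomial (Fin 2) k) : RatFunc₂ k :=
  algebraMap (MvPolynomial (Fin 2) k) (RatFunc₂ k) f

/-- The inclusion `k → V` when `V` is a valuation ring of `k(x,y)` that contains a subfield
`F` of `k(x,y)` over `k`. -/
def constHom {k : Type*} [Field k] (F : IntermediateField k (RatFunc₂ k))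
    (V : ValuationSubring (RatFunc₂ k)) (hF : (F : Set (RatFunc₂ k)) ⊆ V) : k →+* V :=
  (algebraMap k (RatFunc₂ k)).codRestrict V fun c => hF (F.algebraMap_mem c)

/-- The residue field of `V` as an extension of `k`, through `k ⊆ F ⊆ V`. -/
abbrev residueAlgebra {k : Type*} [Field k] (F : IntermediateField k (RatFunc₂ k))
    (V : ValuationSubring (RatFunc₂ k)) (hF : (F : Set (RatFunc₂ k)) ⊆ V) :
    Algebra k (IsLocalRing.ResidueField V) :=
  ((IsLocalRing.residue V).comp (constHom F V hF)).toAlgebra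

/-- The residue in `V / 𝔪_V` of a polynomial `f` with `k(f) ⊆ V`. -/
def resPoly {k : Type*} [Field k] (f : MvPolynomial (Fin 2) k)
    (V : ValuationSubring (RatFunc₂ k))
    (hf : (k⟮toRat f⟯ : Set (RatFunc₂ k)) ⊆ V) : IsLocalRing.ResidueField V :=
  IsLocalRing.residue V ⟨toRat f, hf (IntermediateField.mem_adjoin_simple_self k (toRat f))⟩

/-- `V` is a dicritical divisor of `f`: a discrete valuation ring with quotient field `k(x,y)`
such that `k[x,y] ⊄ V`, `k(f) ⊆ V`, and the residue of `f` is transcendental over `k`. -/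
structure IsDicriticalDivisor {k : Type*} [Field k] (f : MvPolynomial (Fin 2) k)
    (V : ValuationSubring (RatFunc₂ k)) : Prop where
  isDVR : IsDiscreteValuationRing V
  not_subset : ¬ (Set.range (toRat (k := k)) ⊆ V)
  adjoin_subset : (k⟮toRat f⟯ : Set (RatFunc₂ k)) ⊆ V
  transcendental :
    letI : Algebra k (IsLocalRing.ResidueField V) := residueAlgebra k⟮toRat f⟯ V adjoin_subset
    Transcendental k (resPoly f V adjoin_subset)

end

open Polynomial

/-! Since `k[x,y]` is not inside `V`, one of the variables, called `x`, lies outside `V` and so has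
nonzero value. Call `u` residually algebraic if some `u ^ N * x ^ m`, `N > 0`, is a unit with
residue algebraic over `k`. Such elements form a multiplicative group containing `k(x)ˣ`, and their
residues, when defined, are algebraic. As in MacLane's theory of key polynomials, take `φ ∈ k(x)[y]`
of least degree with `φ(y)` nonzero and not residually algebraic; it exists because `f` is itself a
polynomial in `y` over `k(x)`. Let `t` be the nonzero residue of `φ(y) ^ e * w`, with `w` residually
algebraic and `e > 0` least. Dividing repeatedly by `φ`, with residually algebraic remainders, shows
that residues of quotients of polynomials in `y` are rational in `t` over `k'`. For a single
polynomial only nonnegative powers of `φ(y)` occur, so its residue lies in `k'[t]`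
(`exists_hasResidue_div`, `ruled`). -/

namespace ValuationSubring

/-! ### Residues of field elements -/

section Residue

variable {L : Type*} [Field L] {V : ValuationSubring L}

/-- `u` lies in `V` and has residue `a`. -/
def HasResidue (V : ValuationSubring L) (u : L) (a : IsLocalRing.ResidueField V) : Prop :=
  ∃ h : u ∈ V, IsLocalRing.residue V ⟨u, h⟩ = a

namespace HasResidue

variable {u w : L} {a b : IsLocalRing.ResidueField V}

theorem unique (hu : HasResidue V u a) (hw : HasResidue V u b) : a = b := by
  obtain ⟨h, rfl⟩ := hu
  obtain ⟨h', rfl⟩ := hw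
  rfl

theorem one : HasResidue V 1 1 := ⟨V.one_mem, map_one (IsLocalRing.residue V)⟩

theorem add (hu : HasResidue V u a) (hw : HasResidue V w b) : HasResidue V (u + w) (a + b) := by
  obtain ⟨h, rfl⟩ := hu
  obtain ⟨h', rfl⟩ := hw
  exact ⟨V.add_mem _ _ h h', map_add (IsLocalRing.residue V) ⟨u, h⟩ ⟨w, h'⟩⟩

theorem mul (hu : HasResidue V u a) (hw : HasResidue V w b) : HasResidue V (u * w) (a * b) := by
  obtain ⟨h, rfl⟩ := hu
  obtain ⟨h', rfl⟩ := hw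
  exact ⟨V.mul_mem _ _ h h', map_mul (IsLocalRing.residue V) ⟨u, h⟩ ⟨w, h'⟩⟩

theorem pow (hu : HasResidue V u a) (n : ℕ) : HasResidue V (u ^ n) (a ^ n) := by
  obtain ⟨h, rfl⟩ := hu
  exact ⟨pow_mem h n, map_pow (IsLocalRing.residue V) ⟨u, h⟩ n⟩

theorem of_isUnit {c : V} (hc : IsUnit c) : ∃ a ≠ 0, HasResidue V (c : L) a :=
  ⟨IsLocalRing.residue V c, (IsLocalRing.residue_ne_zero_iff_isUnit c).2 hc, c.2, rfl⟩

theorem ne_zero (hu : HasResidue V u a) (ha : a ≠ 0) : u ≠ 0 := by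
  rintro rfl
  obtain ⟨h, rfl⟩ := hu
  exact ha (map_zero (IsLocalRing.residue V))

theorem inv (hu : HasResidue V u a) (ha : a ≠ 0) : HasResidue V u⁻¹ a⁻¹ := by
  have h0 := hu.ne_zero ha
  obtain ⟨h, rfl⟩ := hu
  obtain ⟨c, hc⟩ := (IsLocalRing.residue_ne_zero_iff_isUnit (⟨u, h⟩ : V)).1 ha
  have hcu : u * ((c⁻¹ : Vˣ) : V) = 1 := by
    have := congrArg (Subtype.val) c.mul_inv
    rw [hc] at this
    simpa using this
  have hinv : u⁻¹ = ((c⁻¹ : Vˣ) : V) := by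
    rw [← mul_one u⁻¹, ← hcu, inv_mul_cancel_left₀ h0]
  have hm : u⁻¹ ∈ V := hinv ▸ ((c⁻¹ : Vˣ) : V).2
  refine ⟨hm, ?_⟩
  rw [eq_comm, inv_eq_iff_eq_inv, eq_comm, inv_eq_of_mul_eq_one_left]
  rw [← map_mul]
  convert map_one (IsLocalRing.residue V)
  exact Subtype.ext (mul_inv_cancel₀ h0)

end HasResidue

/-- Every element of the field is a unit of `V`, in the maximal ideal, or has inverse there. -/
theorem hasResidue_trichotomy (V : ValuationSubring L) (u : L) :
    HasResidue V u 0 ∨ (∃ a ≠ 0, HasResidue V u a) ∨ HasResidue V u⁻¹ 0 := by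
  rcases V.mem_or_inv_mem u with h | h
  · by_cases ha : IsLocalRing.residue V ⟨u, h⟩ = 0
    · exact .inl ⟨h, ha⟩
    · exact .inr (.inl ⟨_, ha, h, rfl⟩)
  · by_cases ha : IsLocalRing.residue V ⟨u⁻¹, h⟩ = 0
    · exact .inr (.inr ⟨h, ha⟩)
    · refine .inr (.inl ⟨_, inv_ne_zero ha, ?_⟩)
      simpa using HasResidue.inv ⟨h, rfl⟩ ha

theorem hasResidue_inv_of_notMem {x : L} (hx : x ∉ V) : HasResidue V x⁻¹ 0 := by
  rcases hasResidue_trichotomy V x with ⟨h, -⟩ | ⟨_, _, h, -⟩ | h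
  exacts [absurd h hx, absurd h hx, h]

theorem zpow_eq_zero_of_hasResidue {x : L} (hx : x ∉ V) {m : ℤ}
    {a : IsLocalRing.ResidueField V} (ha : a ≠ 0) (h : HasResidue V (x ^ m) a) : m = 0 := by
  have key : ∀ n : ℕ, ∀ b ≠ 0, HasResidue V (x⁻¹ ^ n) b → n = 0 := fun n b hb hn => by
    by_contra h0
    exact hb (hn.unique (by simpa [h0] using (hasResidue_inv_of_notMem hx).pow n))
  cases m with
  | ofNat n =>
    have := key n _ (inv_ne_zero ha) (by simpa using h.inv ha)
    simp [this]
  | negSucc n =>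
    have := key (n + 1) a ha (by simpa [zpow_negSucc] using h)
    omega

/-- The value group is `ℤ` and `x` has nonzero value, so every value is commensurable with that of
`x`. -/
theorem exists_pow_mul_zpow_hasResidue [IsDiscreteValuationRing V] {x : L} (hx : x ∉ V) {u : L}
    (hu : u ≠ 0) : ∃ N > 0, ∃ m : ℤ, ∃ a ≠ 0, HasResidue V (u ^ N * x ^ m) a := by
  have hx0 : x ≠ 0 := fun h => hx (h ▸ V.zero_mem)
  obtain ⟨hz, hz0⟩ := hasResidue_inv_of_notMem hx
  obtain ⟨ϖ, hϖ⟩ := IsDiscreteValuationRing.exists_irreducible V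
  have hz' : (⟨x⁻¹, hz⟩ : V) ≠ 0 := fun h => inv_ne_zero hx0 (congrArg Subtype.val h)
  obtain ⟨b, c, hbc⟩ := IsDiscreteValuationRing.eq_unit_mul_pow_irreducible hz' hϖ
  have hb : 0 < b := by
    rw [Nat.pos_iff_ne_zero]
    rintro rfl
    rw [hbc, pow_zero, mul_one] at hz0
    exact (IsLocalRing.residue_ne_zero_iff_isUnit (c : V)).2 c.isUnit hz0
  have hxc : x⁻¹ = ((c : V) : L) * (ϖ : L) ^ b := by simpa using congrArg Subtype.val hbc
  have key : ∀ s : L, s ≠ 0 → s ∈ V → ∃ m : ℤ, ∃ a ≠ 0, HasResidue V (s ^ b * x ^ m) a := by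
    intro s hs hsV
    have hs' : (⟨s, hsV⟩ : V) ≠ 0 := fun h => hs (congrArg Subtype.val h)
    obtain ⟨n, d, hnd⟩ := IsDiscreteValuationRing.eq_unit_mul_pow_irreducible hs' hϖ
    have hsd : s = ((d : V) : L) * (ϖ : L) ^ n := by simpa using congrArg Subtype.val hnd
    obtain ⟨α, hα, hd⟩ := HasResidue.of_isUnit d.isUnit
    obtain ⟨γ, hγ, hc⟩ := HasResidue.of_isUnit c.isUnit
    have hϖ0 : (ϖ : L) ≠ 0 := fun h => hϖ.ne_zero (Subtype.ext h)
    have hc0 := hc.ne_zero hγ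
    -- The orders of `s` and `x` are `n` and `-b`, so `s ^ b * x ^ n` has order zero.
    refine ⟨n, α ^ b * (γ⁻¹) ^ n, mul_ne_zero (pow_ne_zero _ hα)
      (pow_ne_zero _ (inv_ne_zero hγ)), ?_⟩
    convert (hd.pow b).mul ((hc.inv hγ).pow n) using 1
    rw [hsd, ← inv_inv x, hxc, zpow_natCast]
    rw [mul_pow, ← pow_mul, inv_pow, mul_pow, ← pow_mul, mul_comm n b, inv_pow, mul_inv]
    field_simp
  refine ⟨b, hb, ?_⟩
  rcases V.mem_or_inv_mem u with h | h
  · exact key u hu h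
  · obtain ⟨m, a, ha, hm⟩ := key u⁻¹ (inv_ne_zero hu) h
    refine ⟨-m, a⁻¹, inv_ne_zero ha, ?_⟩
    convert hm.inv ha using 1
    simp [mul_comm]

end Residue

/-! ### The group of residually algebraic elements -/

section ResiduallyAlgebraic

variable {k L : Type*} [Field k] [Field L] {V : ValuationSubring L}
  [Algebra k (IsLocalRing.ResidueField V)]

variable (k V) in
/-- Some positive power of `u` times a power of `x` is a unit of `V` with residue algebraic
over `k`. -/
def ResiduallyAlgebraic (x u : L) : Prop :=
  ∃ N > 0, ∃ m : ℤ, ∃ a ≠ 0, IsAlgebraic k a ∧ HasResidue V (u ^ N * x ^ m) a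

theorem HasResidue.residuallyAlgebraic {x u : L} {a : IsLocalRing.ResidueField V}
    (hu : HasResidue V u a) (h0 : a ≠ 0) (ha : IsAlgebraic k a) :
    ResiduallyAlgebraic k V x u :=
  ⟨1, one_pos, 0, a, h0, ha, by simpa using hu⟩

namespace ResiduallyAlgebraic

variable {x u w : L}

theorem one : ResiduallyAlgebraic k V x 1 :=
  HasResidue.one.residuallyAlgebraic one_ne_zero isAlgebraic_one

theorem self (hx : x ≠ 0) : ResiduallyAlgebraic k V x x :=
  ⟨1, one_pos, -1, 1, one_ne_zero, isAlgebraic_one, by simpa [hx] using HasResidue.one⟩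

theorem ne_zero (hu : ResiduallyAlgebraic k V x u) : u ≠ 0 := by
  rintro rfl
  obtain ⟨N, hN, m, a, ha, -, h⟩ := hu
  exact h.ne_zero ha (by simp [hN.ne'])

theorem inv (hu : ResiduallyAlgebraic k V x u) : ResiduallyAlgebraic k V x u⁻¹ := by
  obtain ⟨N, hN, m, a, h0, ha, h⟩ := hu
  refine ⟨N, hN, -m, a⁻¹, inv_ne_zero h0, ha.inv, ?_⟩
  convert h.inv h0 using 1
  simp [mul_comm]

theorem mul (hx : x ≠ 0) (hu : ResiduallyAlgebraic k V x u) (hw : ResiduallyAlgebraic k V x w) :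
    ResiduallyAlgebraic k V x (u * w) := by
  obtain ⟨N, hN, m, a, h0, ha, h⟩ := hu
  obtain ⟨N', hN', m', a', h0', ha', h'⟩ := hw
  refine ⟨N * N', Nat.mul_pos hN hN', m * N' + m' * N, a ^ N' * a' ^ N,
    mul_ne_zero (pow_ne_zero _ h0) (pow_ne_zero _ h0'), (ha.pow _).mul (ha'.pow _), ?_⟩
  convert (h.pow N').mul (h'.pow N) using 1
  rw [zpow_add₀ hx, zpow_mul, zpow_mul, zpow_natCast, zpow_natCast]
  ring

theorem pow (hx : x ≠ 0) (hu : ResiduallyAlgebraic k V x u) (n : ℕ) :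
    ResiduallyAlgebraic k V x (u ^ n) := by
  induction n with
  | zero => simpa using one
  | succ n ih => rw [pow_succ]; exact ih.mul hx hu

theorem zpow (hx : x ≠ 0) (hu : ResiduallyAlgebraic k V x u) (n : ℤ) :
    ResiduallyAlgebraic k V x (u ^ n) := by
  cases n with
  | ofNat n => simpa using hu.pow hx n
  | negSucc n => rw [zpow_negSucc]; exact (hu.pow hx _).inv

theorem of_pow {n : ℕ} (hn : 0 < n) (hu : ResiduallyAlgebraic k V x (u ^ n)) :
    ResiduallyAlgebraic k V x u := by
  obtain ⟨N, hN, m, a, h0, ha, h⟩ := hu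
  exact ⟨n * N, Nat.mul_pos hn hN, m, a, h0, ha, by rwa [pow_mul]⟩

/-- If `u` is a unit, then so is `x ^ m`, which forces `m = 0`; a power of the residue is then
algebraic. -/
theorem isAlgebraic (hx : x ∉ V) (hu : ResiduallyAlgebraic k V x u)
    {a : IsLocalRing.ResidueField V} (ha : HasResidue V u a) : IsAlgebraic k a := by
  by_cases h0 : a = 0
  · rw [h0]; exact isAlgebraic_zero
  obtain ⟨N, hN, m, b, hb0, hb, h⟩ := hu
  have hm : HasResidue V (x ^ m) ((a ^ N)⁻¹ * b) := by
    convert ((ha.pow N).inv (pow_ne_zero _ h0)).mul h using 1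
    rw [inv_mul_cancel_left₀ (pow_ne_zero _ (ha.ne_zero h0))]
  obtain rfl := zpow_eq_zero_of_hasResidue hx
    (mul_ne_zero (inv_ne_zero (pow_ne_zero _ h0)) hb0) hm
  rw [zpow_zero, mul_one] at h
  rw [h.unique (ha.pow N)] at hb
  exact hb.of_pow hN

end ResiduallyAlgebraic

variable [Algebra k L]

theorem HasResidue.aeval
    (hk : ∀ c : k, HasResidue V (algebraMap k L c) (algebraMap k _ c)) {z : L}
    {a : IsLocalRing.ResidueField V} (hz : HasResidue V z a) (p : k[X]) :
    HasResidue V (aeval z p) (aeval a p) := by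
  induction p using Polynomial.induction_on' with
  | add p q hp hq => simpa using hp.add hq
  | monomial n c => simpa [aeval_monomial] using (hk c).mul (hz.pow n)

theorem residuallyAlgebraic_of_mem_adjoin
    (hk : ∀ c : k, HasResidue V (algebraMap k L c) (algebraMap k _ c)) {x : L} (hx : x ∉ V)
    {c : L} (hc : c ∈ IntermediateField.adjoin k {x}) (h0 : c ≠ 0) :
    ResiduallyAlgebraic k V x c := by
  have hx0 : x ≠ 0 := fun h => hx (h ▸ V.zero_mem)
  have key : ∀ p : k[X], aeval x p ≠ 0 → ResiduallyAlgebraic k V x (aeval x p) := by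
    intro p hp
    have hp0 : p ≠ 0 := by rintro rfl; simp at hp
    -- `x⁻¹` has residue zero, so the reversed polynomial at `x⁻¹` has the leading coefficient of
    -- `p` as residue.
    have h1 := HasResidue.aeval hk (hasResidue_inv_of_notMem hx) p.reverse
    rw [← coeff_zero_eq_aeval_zero', coeff_zero_reverse] at h1
    have h2 : Polynomial.aeval x p = Polynomial.aeval x⁻¹ p.reverse * x ^ p.natDegree := by
      let _ := invertibleOfNonzero hx0
      have := eval₂_reverse_mul_pow (algebraMap k L) x p
      rw [invOf_eq_inv] at this
      exact this.symm
    rw [h2]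
    exact (h1.residuallyAlgebraic (by simpa using hp0) (isAlgebraic_algebraMap _)).mul hx0
      ((ResiduallyAlgebraic.self hx0).pow hx0 _)
  obtain ⟨r, s, rfl⟩ := (IntermediateField.mem_adjoin_simple_iff k c).1 hc
  rw [div_ne_zero_iff] at h0
  rw [div_eq_mul_inv]
  exact (key r h0.1).mul hx0 (key s h0.2).inv

end ResiduallyAlgebraic

/-! ### The generator of the residue field -/

section ResidualGenerator

variable {k L : Type*} [Field k] [Field L] {V : ValuationSubring L}
  [Algebra k (IsLocalRing.ResidueField V)]

variable (k V) in
/-- `t` is the residue of `z ^ e * w`, where `w` is residually algebraic and `e` is the least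
positive exponent for which such a product can be a unit of `V`. -/
structure IsResidualGenerator (x z : L) (e : ℕ) (w : L) (t : IsLocalRing.ResidueField V) :
    Prop where
  pos : 0 < e
  residuallyAlgebraic : ResiduallyAlgebraic k V x w
  ne_zero : t ≠ 0
  hasResidue : HasResidue V (z ^ e * w) t
  minimal : ∀ j > 0, ∀ w', ResiduallyAlgebraic k V x w' →
    ∀ a ≠ 0, HasResidue V (z ^ j * w') a → e ≤ j

theorem exists_isResidualGenerator [IsDiscreteValuationRing V] {x z : L} (hx : x ∉ V)
    (hz : z ≠ 0) : ∃ e w t, IsResidualGenerator k V x z e w t := by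
  classical
  have hx0 : x ≠ 0 := fun h => hx (h ▸ V.zero_mem)
  have hex : ∃ j > 0, ∃ w, ResiduallyAlgebraic k V x w ∧ ∃ a ≠ 0, HasResidue V (z ^ j * w) a := by
    obtain ⟨N, hN, m, a, ha, h⟩ := exists_pow_mul_zpow_hasResidue hx hz
    exact ⟨N, hN, x ^ m, (ResiduallyAlgebraic.self hx0).zpow hx0 m, a, ha, h⟩
  obtain ⟨h0, w, hw, t, ht, h⟩ := Nat.find_spec hex
  exact ⟨Nat.find hex, w, t, h0, hw, ht, h, fun j hj w' hw' a ha h' =>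
    Nat.find_min' hex ⟨hj, w', hw', a, ha, h'⟩⟩

namespace IsResidualGenerator

variable {x z w : L} {e : ℕ} {t : IsLocalRing.ResidueField V}

/-- Were `t` algebraic, `z ^ e = (z ^ e * w) * w⁻¹` would be residually algebraic, and hence `z`
too. -/
theorem transcendental (h : IsResidualGenerator k V x z e w t) (hx : x ∉ V)
    (hz : ¬ ResiduallyAlgebraic k V x z) : Transcendental k t := by
  have hx0 : x ≠ 0 := fun h => hx (h ▸ V.zero_mem)
  intro ht
  refine hz (.of_pow h.pos ?_)
  have := (h.hasResidue.residuallyAlgebraic (x := x) h.ne_zero ht).mul hx0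
    h.residuallyAlgebraic.inv
  rwa [mul_inv_cancel_right₀ h.residuallyAlgebraic.ne_zero] at this

/-- The residue of a unit `z ^ j * w'` is a constant times a power of the generator. -/
theorem exists_eq_mul_pow (h : IsResidualGenerator k V x z e w t) (hx : x ∉ V) {j : ℕ} {w' : L}
    (hw' : ResiduallyAlgebraic k V x w') {b : IsLocalRing.ResidueField V} (hb : b ≠ 0)
    (hres : HasResidue V (z ^ j * w') b) :
    ∃ (β : algebraicClosure k (IsLocalRing.ResidueField V)) (m : ℕ), j = e * m ∧
      b = β * t ^ m := by
  have hx0 : x ≠ 0 := fun h => hx (h ▸ V.zero_mem)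
  have hz0 : z ≠ 0 := by
    rintro rfl
    exact h.hasResidue.ne_zero h.ne_zero (by simp [h.pos.ne'])
  have hw0 := h.residuallyAlgebraic.ne_zero
  have hRA : ResiduallyAlgebraic k V x (w' * (w ^ (j / e))⁻¹) :=
    hw'.mul hx0 (h.residuallyAlgebraic.pow hx0 _).inv
  have hr : HasResidue V (z ^ (j % e) * (w' * (w ^ (j / e))⁻¹)) (b * (t ^ (j / e))⁻¹) := by
    convert hres.mul ((h.hasResidue.pow (j / e)).inv (pow_ne_zero _ h.ne_zero)) using 1
    have : z ^ j = z ^ (j % e) * (z ^ e) ^ (j / e) := by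
      rw [← pow_mul, ← pow_add, Nat.mod_add_div]
    rw [this, mul_pow]
    field_simp
  have hb' : b * (t ^ (j / e))⁻¹ ≠ 0 := mul_ne_zero hb (inv_ne_zero (pow_ne_zero _ h.ne_zero))
  -- A nonzero remainder would be a smaller positive exponent than `e`.
  have hmod : j % e = 0 := by
    by_contra hne
    exact absurd (h.minimal _ (Nat.pos_of_ne_zero hne) _ hRA _ hb' hr)
      (not_le.2 (Nat.mod_lt _ h.pos))
  rw [hmod, pow_zero, one_mul] at hr
  refine ⟨⟨_, mem_algebraicClosure_iff.2 (hRA.isAlgebraic hx hr)⟩, j / e,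
    (Nat.mul_div_cancel' (Nat.dvd_of_mod_eq_zero hmod)).symm, ?_⟩
  simp [inv_mul_cancel_right₀ (pow_ne_zero _ h.ne_zero)]

/-- Quotients of polynomials bring in negative powers of `z`; inverting reduces these to nonnegative
ones. -/
theorem mem_adjoin (h : IsResidualGenerator k V x z e w t) (hx : x ∉ V) {i j : ℕ} {w' : L}
    (hw' : ResiduallyAlgebraic k V x w') {b : IsLocalRing.ResidueField V} (hb : b ≠ 0)
    (hres : HasResidue V (z ^ i * (z ^ j)⁻¹ * w') b) :
    b ∈ IntermediateField.adjoin (algebraicClosure k (IsLocalRing.ResidueField V)) {t} := by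
  have hz0 : z ≠ 0 := by
    rintro rfl
    exact h.hasResidue.ne_zero h.ne_zero (by simp [h.pos.ne'])
  have key : ∀ n : ℕ, ∀ s : L, ResiduallyAlgebraic k V x s → ∀ a ≠ 0, HasResidue V (z ^ n * s) a →
      a ∈ IntermediateField.adjoin (algebraicClosure k (IsLocalRing.ResidueField V)) {t} := by
    intro n s hs a ha hn
    obtain ⟨β, m, -, rfl⟩ := h.exists_eq_mul_pow hx hs ha hn
    exact IntermediateField.mul_mem _ (IntermediateField.algebraMap_mem _ β)
      (pow_mem (IntermediateField.mem_adjoin_simple_self _ t) m)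
  rcases le_total j i with hij | hij
  · refine key (i - j) w' hw' b hb ?_
    rwa [pow_sub₀ z hz0 hij]
  · rw [← inv_inv b]
    refine IntermediateField.inv_mem _ (key (j - i) w'⁻¹ hw'.inv b⁻¹ (inv_ne_zero hb) ?_)
    convert hres.inv hb using 1
    rw [pow_sub₀ z hz0 hij]
    simp [mul_comm]

end IsResidualGenerator

end ResidualGenerator

/-! ### Division by the minimal polynomial `φ` -/

section Expansion

variable {k L K : Type*} [Field k] [Field L] [Field K] [Algebra K L] {V : ValuationSubring L}
  [Algebra k (IsLocalRing.ResidueField V)]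

/-- If `φ(y)` is not residually algebraic and `φ` has the least possible degree, then every
nonzero `p(y)` is, up to a factor `φ(y) ^ i * w'` with `w'` residually algebraic, a unit whose
residue is a polynomial in the generator with constant coefficient `1`. -/
theorem IsResidualGenerator.exists_hasResidue_div {x y w : L} {φ : K[X]} {e : ℕ}
    {t : IsLocalRing.ResidueField V}
    (h : IsResidualGenerator k V x (aeval y φ) e w t) (hx : x ∉ V)
    (hmin : ∀ r : K[X], r.degree < φ.degree → aeval y r ≠ 0 →
      ResiduallyAlgebraic k V x (aeval y r))
    (hpos : 0 < φ.degree) (p : K[X]) (hp : aeval y p ≠ 0) :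
    ∃ (i : ℕ) (w' : L) (P : (algebraicClosure k (IsLocalRing.ResidueField V))[X]),
      ResiduallyAlgebraic k V x w' ∧ P.coeff 0 = 1 ∧
      HasResidue V (aeval y p * (aeval y φ ^ i * w')⁻¹) (aeval t P) := by
  have hx0 : x ≠ 0 := fun h => hx (h ▸ V.zero_mem)
  have hz0 : aeval y φ ≠ 0 := fun h0 =>
    h.hasResidue.ne_zero h.ne_zero (by simp [h0, h.pos.ne'])
  have hφ0 : φ ≠ 0 := by rintro rfl; simp at hz0
  have hsmall : ∀ r : K[X], r.degree < φ.degree → ∀ s : L, s = aeval y r → s ≠ 0 →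
      ∃ (i : ℕ) (w' : L) (P : (algebraicClosure k (IsLocalRing.ResidueField V))[X]),
        ResiduallyAlgebraic k V x w' ∧ P.coeff 0 = 1 ∧
        HasResidue V (s * (aeval y φ ^ i * w')⁻¹) (aeval t P) := by
    rintro r hr s rfl hs
    exact ⟨0, aeval y r, 1, hmin r hr hs, by simp, by simpa [hs] using HasResidue.one⟩
  induction hd : p.degree using WellFoundedLT.induction generalizing p with
  | ind n ih =>
    subst hd
    by_cases hlt : p.degree < φ.degree
    · exact hsmall p hlt _ rfl hp
    have hp0 : p ≠ 0 := by rintro rfl; simp at hp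
    have hdec : aeval y p = aeval y φ * aeval y (p / φ) + aeval y (p % φ) := by
      rw [← map_mul, ← map_add, EuclideanDomain.div_add_mod]
    have hr := degree_mod_lt p hφ0
    by_cases hq0 : aeval y (p / φ) = 0
    · exact hsmall _ hr _ (by simp [hdec, hq0]) hp
    obtain ⟨i, w', P, hw', hP, hres⟩ := ih _ (degree_div_lt hp0 hpos) (p / φ) hq0 rfl
    have hw0 := hw'.ne_zero
    set z := aeval y φ
    set q := aeval y (p / φ)
    set s := aeval y (p % φ) with hs
    have hres' : HasResidue V (z * q * (z ^ (i + 1) * w')⁻¹) (aeval t P) := by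
      convert hres using 1
      field_simp
      ring
    by_cases hs0 : s = 0
    · exact ⟨i + 1, w', P, hw', hP, by rwa [hdec, hs0, add_zero]⟩
    have hsRA := hmin _ hr hs0
    -- Compare the values of `z * q` and the remainder `s`: the dominant term supplies the
    -- normalising factor. At equal values `s` is used, and the residue of `z * q / s` adds a
    -- multiple of `t ^ m`; here `m > 0` because `i + 1 > 0`, so the constant coefficient stays `1`.
    rcases hasResidue_trichotomy V (z ^ (i + 1) * (w' * s⁻¹)) with h1 | ⟨b, hb, h1⟩ | h1
    · refine ⟨0, s, 1, hsRA, by simp, ?_⟩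
      convert (hres'.mul h1).add HasResidue.one using 1
      · rw [hdec]; field_simp
      · simp
    · obtain ⟨β, m, hm, rfl⟩ := h.exists_eq_mul_pow hx (hw'.mul hx0 hsRA.inv) hb h1
      have hm0 : m ≠ 0 := by rintro rfl; simp at hm
      refine ⟨0, s, P * (C β * X ^ m) + 1, hsRA, ?_, ?_⟩
      · simp [mul_coeff_zero, hm0.symm, coeff_X_pow]
      convert (hres'.mul h1).add HasResidue.one using 1
      · rw [hdec]; field_simp
      · simp
    · refine ⟨i + 1, w', P, hw', hP, ?_⟩
      convert hres'.add h1 using 1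
      · rw [hdec]; field_simp
      · simp

theorem IsResidualGenerator.ruled {x y w : L} {φ : K[X]} {e : ℕ}
    {t : IsLocalRing.ResidueField V}
    (h : IsResidualGenerator k V x (aeval y φ) e w t) (hx : x ∉ V)
    (hφ : ¬ ResiduallyAlgebraic k V x (aeval y φ))
    (hmin : ∀ r : K[X], r.degree < φ.degree → aeval y r ≠ 0 →
      ResiduallyAlgebraic k V x (aeval y r))
    (hpos : 0 < φ.degree)
    (hfrac : ∀ u : L, ∃ p q : K[X], u = aeval y p / aeval y q) :
    IntermediateField.adjoin (algebraicClosure k (IsLocalRing.ResidueField V)) {t} = ⊤ ∧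
    ∀ (p : K[X]) (b : IsLocalRing.ResidueField V), HasResidue V (aeval y p) b →
      b ∈ Algebra.adjoin (algebraicClosure k (IsLocalRing.ResidueField V)) {t} := by
  have hx0 : x ≠ 0 := fun h => hx (h ▸ V.zero_mem)
  have hz0 : aeval y φ ≠ 0 := fun h0 =>
    h.hasResidue.ne_zero h.ne_zero (by simp [h0, h.pos.ne'])
  have ht : Transcendental (algebraicClosure k (IsLocalRing.ResidueField V)) t := fun ht =>
    h.transcendental hx hφ (ht.restrictScalars k)
  have hP0 : ∀ P : (algebraicClosure k (IsLocalRing.ResidueField V))[X], P.coeff 0 = 1 →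
      aeval t P ≠ 0 := by
    intro P hP hP'
    rw [transcendental_iff] at ht
    simp [ht P hP'] at hP
  have hexp := h.exists_hasResidue_div hx hmin hpos
  constructor
  · refine _root_.eq_top_iff.2 fun b _ => ?_
    by_cases hb : b = 0
    · rw [hb]; exact IntermediateField.zero_mem _
    obtain ⟨⟨u, hu⟩, rfl⟩ := IsLocalRing.residue_surjective b
    have hub : HasResidue V u (IsLocalRing.residue V ⟨u, hu⟩) := ⟨hu, rfl⟩
    generalize IsLocalRing.residue V ⟨u, hu⟩ = b at hb hub
    obtain ⟨p, q, rfl⟩ := hfrac u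
    have hpq := hub.ne_zero hb
    rw [div_ne_zero_iff] at hpq
    obtain ⟨i, w₁, P, hw₁, hP, h₁⟩ := hexp p hpq.1
    obtain ⟨j, w₂, Q, hw₂, hQ, h₂⟩ := hexp q hpq.2
    have hw₁0 := hw₁.ne_zero
    have hw₂0 := hw₂.ne_zero
    have hPt := hP0 P hP
    have hQt := hP0 Q hQ
    have hmem : ∀ R : (algebraicClosure k (IsLocalRing.ResidueField V))[X],
        aeval t R ∈ IntermediateField.adjoin
          (algebraicClosure k (IsLocalRing.ResidueField V)) {t} := fun R =>
      IntermediateField.algebra_adjoin_le_adjoin _ _ (aeval_mem_adjoin_singleton _ t)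
    -- Removing the factors `P(t)` and `Q(t)` leaves the residue of a monomial `z ^ i * (z ^ j)⁻¹`
    -- times a residually algebraic element.
    have hmon : b * (aeval t P)⁻¹ * aeval t Q ∈ IntermediateField.adjoin
        (algebraicClosure k (IsLocalRing.ResidueField V)) {t} := by
      refine h.mem_adjoin hx (i := i) (j := j) (hw₁.mul hx0 hw₂.inv)
        (mul_ne_zero (mul_ne_zero hb (inv_ne_zero hPt)) hQt) ?_
      convert (hub.mul (h₁.inv hPt)).mul h₂ using 1
      have := hpq.1
      have := hpq.2
      field_simp
    have := IntermediateField.mul_mem _ (IntermediateField.mul_mem _ hmon (hmem P))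
      (IntermediateField.inv_mem _ (hmem Q))
    convert this using 1
    field_simp
  · intro p b hpb
    by_cases hb : b = 0
    · rw [hb]; exact Subalgebra.zero_mem _
    have hp := hpb.ne_zero hb
    obtain ⟨i, w₁, P, hw₁, hP, h₁⟩ := hexp p hp
    have hw₁0 := hw₁.ne_zero
    have hPt := hP0 P hP
    have hmon : HasResidue V (aeval y φ ^ i * w₁) (b * (aeval t P)⁻¹) := by
      convert hpb.mul (h₁.inv hPt) using 1
      field_simp
    obtain ⟨β, m, -, hβ⟩ := h.exists_eq_mul_pow hx hw₁ (mul_ne_zero hb (inv_ne_zero hPt)) hmon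
    have hbeq : b = aeval t (C β * X ^ m * P) := by
      rw [map_mul, ← mul_inv_eq_iff_eq_mul₀ hPt, hβ]
      simp
    rw [hbeq]
    exact aeval_mem_adjoin_singleton _ t

end Expansion

/-- Let `V` be a discrete valuation ring of `L = k(x, y)` with `x ∉ V`. If some polynomial in `y`
over `k(x)` has a residue transcendental over `k`, then the residue field of `V` is `k'(t)` with
`k'` the algebraic closure of `k` in it, and residues of polynomials in `y` lie in `k'[t]`. -/
theorem exists_transcendental_generator {k L : Type*} [Field k] [Field L] [Algebra k L]
    {V : ValuationSubring L} [IsDiscreteValuationRing V]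
    [Algebra k (IsLocalRing.ResidueField V)]
    (hk : ∀ c : k, HasResidue V (algebraMap k L c) (algebraMap k _ c)) {x y : L} (hx : x ∉ V)
    (hfrac : ∀ u : L, ∃ p q : (IntermediateField.adjoin k {x})[X], u = aeval y p / aeval y q)
    {p : (IntermediateField.adjoin k {x})[X]} {b : IsLocalRing.ResidueField V}
    (hpb : HasResidue V (aeval y p) b) (hb : Transcendental k b) :
    ∃ t : IsLocalRing.ResidueField V, Transcendental k t ∧
      IntermediateField.adjoin (algebraicClosure k (IsLocalRing.ResidueField V)) {t} = ⊤ ∧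
      b ∈ Algebra.adjoin (algebraicClosure k (IsLocalRing.ResidueField V)) {t} := by
  let S : Set (IntermediateField.adjoin k {x})[X] :=
    {q | aeval y q ≠ 0 ∧ ¬ ResiduallyAlgebraic k V x (aeval y q)}
  have hb0 : b ≠ 0 := by
    rintro rfl
    exact hb isAlgebraic_zero
  have hS : S.Nonempty := ⟨p, hpb.ne_zero hb0, fun h => hb (h.isAlgebraic hx hpb)⟩
  obtain ⟨φ, ⟨hφ0, hφ⟩, hφmin⟩ :=
    (InvImage.wf (degree (R := IntermediateField.adjoin k {x})) wellFounded_lt).has_min S hS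
  have hmin : ∀ r : (IntermediateField.adjoin k {x})[X], r.degree < φ.degree → aeval y r ≠ 0 →
      ResiduallyAlgebraic k V x (aeval y r) := by
    intro r hr hr0
    by_contra hne
    exact hφmin r ⟨hr0, hne⟩ hr
  have hpos : 0 < φ.degree := by
    -- A constant `φ` would lie in `k(x)`, whose nonzero elements are residually algebraic.
    by_contra hle
    rw [eq_C_of_degree_le_zero (not_lt.1 hle), aeval_C] at hφ hφ0
    exact hφ (residuallyAlgebraic_of_mem_adjoin hk hx (φ.coeff 0).2 hφ0)
  obtain ⟨e, w, t, h⟩ := exists_isResidualGenerator (k := k) hx hφ0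
  obtain ⟨h1, h2⟩ := h.ruled hx hφ hmin hpos hfrac
  exact ⟨t, h.transcendental hx hφ, h1, h2 p b hpb⟩

end ValuationSubring

/-! ### Application to `k[x, y]` -/

/-- `k[x, y] ⊆ k(x)[y]`, for either choice of the variable `x`. -/
theorem exists_aeval_eq_toRat {k : Type*} [Field k] {i j : Fin 2} (hij : ∀ l, l = i ∨ l = j)
    (g : MvPolynomial (Fin 2) k) :
    ∃ p : (IntermediateField.adjoin k {toRat (MvPolynomial.X (R := k) i)})[X],
      aeval (toRat (MvPolynomial.X (R := k) j)) p = toRat g := by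
  induction g using MvPolynomial.induction_on with
  | C c =>
    refine ⟨C (algebraMap k _ c), ?_⟩
    rw [aeval_C, ← IsScalarTower.algebraMap_apply, toRat, ← MvPolynomial.algebraMap_eq,
      ← IsScalarTower.algebraMap_apply]
  | add g h hg hh =>
    obtain ⟨p, hp⟩ := hg
    obtain ⟨q, hq⟩ := hh
    exact ⟨p + q, by simp [hp, hq]⟩
  | mul_X g l hg =>
    obtain ⟨p, hp⟩ := hg
    rcases hij l with rfl | rfl
    · refine ⟨p * C ⟨_, IntermediateField.mem_adjoin_simple_self k _⟩, ?_⟩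
      rw [map_mul, hp, aeval_C]
      exact (map_mul _ _ _).symm
    · exact ⟨p * X, by simp [hp]⟩

theorem mainTheorem3 {k : Type*} [Field k] (f : MvPolynomial (Fin 2) k)
    (hf : f ∉ Set.range (MvPolynomial.C : k →+* MvPolynomial (Fin 2) k))
    (V : ValuationSubring (RatFunc₂ k)) (hV : IsDicriticalDivisor f V) :
    letI : Algebra k (IsLocalRing.ResidueField V) :=
      residueAlgebra k⟮toRat f⟯ V hV.adjoin_subset
    ∃ t : IsLocalRing.ResidueField V,
      Transcendental k t ∧
      IntermediateField.adjoin (algebraicClosure k (IsLocalRing.ResidueField V)) {t} = ⊤ ∧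
      resPoly f V hV.adjoin_subset ∈
        Algebra.adjoin (algebraicClosure k (IsLocalRing.ResidueField V)) {t} := by
  let _ : Algebra k (IsLocalRing.ResidueField V) := residueAlgebra k⟮toRat f⟯ V hV.adjoin_subset
  have := hV.isDVR
  have hkV : ∀ c : k, algebraMap k (RatFunc₂ k) c ∈ V := fun c =>
    hV.adjoin_subset (IntermediateField.algebraMap_mem _ c)
  have hk : ∀ c : k, V.HasResidue (algebraMap k (RatFunc₂ k) c) (algebraMap k _ c) :=
    fun c => ⟨hkV c, rfl⟩
  obtain ⟨i, hi⟩ : ∃ i : Fin 2, toRat (MvPolynomial.X (R := k) i) ∉ V := by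
    by_contra! hall
    refine hV.not_subset ?_
    rintro _ ⟨g, rfl⟩
    show toRat g ∈ V
    induction g using MvPolynomial.induction_on with
    | C c =>
      rw [toRat, ← MvPolynomial.algebraMap_eq, ← IsScalarTower.algebraMap_apply]
      exact hkV c
    | add g h hg hh => rw [toRat, map_add]; exact V.add_mem _ _ hg hh
    | mul_X g l hg => rw [toRat, map_mul]; exact V.mul_mem _ _ hg (hall l)
  obtain ⟨j, hij⟩ : ∃ j : Fin 2, ∀ l, l = i ∨ l = j := by
    have : ∀ i : Fin 2, ∃ j : Fin 2, ∀ l, l = i ∨ l = j := by decide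
    exact this i
  have hfrac : ∀ u : RatFunc₂ k,
      ∃ p q : (IntermediateField.adjoin k {toRat (MvPolynomial.X (R := k) i)})[X],
        u = aeval (toRat (MvPolynomial.X (R := k) j)) p /
          aeval (toRat (MvPolynomial.X (R := k) j)) q := by
    intro u
    obtain ⟨g, h, -, rfl⟩ := IsFractionRing.div_surjective (A := MvPolynomial (Fin 2) k) u
    obtain ⟨p, hp⟩ := exists_aeval_eq_toRat hij g
    obtain ⟨q, hq⟩ := exists_aeval_eq_toRat hij h
    exact ⟨p, q, by rw [hp, hq]⟩
  obtain ⟨p, hp⟩ := exists_aeval_eq_toRat hij f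
  exact ValuationSubring.exists_transcendental_generator hk hi hfrac
    (p := p) ⟨hp ▸ hV.adjoin_subset (IntermediateField.mem_adjoin_simple_self k (toRat f)),
      by simp only [hp]; rfl⟩ hV.transcendental
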